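/- Let $(S_n)_{n\ge 0}$ and $(T_n)_{n\ge 0}$ be the integer sequences defined by $S_0=0$, $S_1=1$, $S_{n+1}=4S_n-S_{n-1}$ and $T_0=2$, $T_1=4$, $T_{n+1}=4T_n-T_{n-1}$ for $n\ge 1$. Write $\left(\frac{\cdot}{\cdot}\right)$ for the Jacobi symbol, and for rational numbers $a,b$ and a positive integer $m$ let $a\equiv b\pmod m$ mean that $a-b=mz$ for some rational $z$ whose denominator in lowest terms is coprime to $m$. Let $p>3$ be a prime. Then $$\sum_{k=0}^{p-1}S_k\binom{2k}{k}\equiv 2\left(\left(\frac p3\right)-\left(\frac{-1}p\right)\right)\pmod{p^2},$$ $$\sum_{k=0}^{p-1}S_{k+1}\binom{2k}{k}\equiv\left(\frac p3\right)\pmod{p^2},$$ $$\sum_{k=0}^{(p-1)/2}\frac{S_k}{16^k}\binom{2k}{k}\equiv\frac{\left(\frac 6p\right)-\left(\frac 2p\right)}2\pmod{p^2},$$ $$\sum_{k=0}^{(p-1)/2}\frac{T_k}{16^k}\binom{2k}{k}\equiv 3\left(\frac 6p\right)-\left(\frac 2p\right)\pmod{p^2}.$$ -/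

import Mathlib

/-- The sequence `S_n = u_n(4, 1)`: `S_0 = 0`, `S_1 = 1`, `S_{n+1} = 4 S_n - S_{n-1}`. -/
def seqS : ℕ → ℤ
  | 0 => 0
  | 1 => 1
  | n + 2 => 4 * seqS (n + 1) - seqS n

/-- The sequence `T_n = v_n(4, 1)`: `T_0 = 2`, `T_1 = 4`, `T_{n+1} = 4 T_n - T_{n-1}`. -/
def seqT : ℕ → ℤ
  | 0 => 2
  | 1 => 4
  | n + 2 => 4 * seqT (n + 1) - seqT n

/-- Congruence of rational numbers modulo a natural number `m`: the difference `a - b` is `m` times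
a rational number whose denominator (in lowest terms) is coprime to `m`. -/
def RatModEq (m : ℕ) (a b : ℚ) : Prop :=
  ∃ z : ℚ, Nat.Coprime z.den m ∧ a - b = (m : ℚ) * z

/-! ### Binomial sums in a commutative ring -/

section BinomialSums

variable {R : Type*} [CommRing R]

/-! Let a = 2 + √3, m = 1/a = 2 - √3, p = 2n + 1. Since a^k = T_k/2 + S_k√3, all four sums are
coordinates of sums of a^k times binomials in ℤ[√3]. For the first two, let u = `lucasU` and g = u_n
+ u_{n+1}. Telescoping (`pow_mul_sum_centralBinom_mul_pow`) turns ∑ a^k C(2k,k) into a sum of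
C(2p,k) u_{p-k}. As C(2p,k) ≡ 2 C(p,k) mod p² for 0 < k < p, and ∑ C(p,k) u_k = m^n g, the sum is ≡
2a^n g - a^{2n} u_p. Here a^n is known only mod p, from (1+√3)^p ≡ 1 + 3^n √3, but completing the
square makes that enough mod p². For the last two, C(2k,k)/16^k ≡ (-1)^k C(n+k,2k) mod p², which
gives a Morgan-Voyce polynomial at -a. Both u and the Morgan-Voyce values have period 12, so only p
mod 24 matters. -/

theorem sum_choose_succ_mul (N M : ℕ) (f : ℕ → R) :
    ∑ k ∈ Finset.range (N + 1), ((M + 1).choose k : R) * f k =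
      ∑ k ∈ Finset.range (N + 1), (M.choose k : R) * f k +
        ∑ k ∈ Finset.range N, (M.choose k : R) * f (k + 1) := by
  rw [Finset.sum_range_succ', Finset.sum_range_succ' (fun k => (M.choose k : R) * f k)]
  simp only [Nat.choose_succ_succ', Nat.cast_add, add_mul, Finset.sum_add_distrib,
    Nat.choose_zero_right]
  ring

theorem sum_choose_succ_mul_full (N : ℕ) (f : ℕ → R) :
    ∑ k ∈ Finset.range (N + 2), ((N + 1).choose k : R) * f k =
      ∑ k ∈ Finset.range (N + 1), (N.choose k : R) * (f k + f (k + 1)) := by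
  rw [sum_choose_succ_mul, Finset.sum_range_succ (fun k => (N.choose k : R) * f k) (N + 1),
    Nat.choose_succ_self]
  simp [mul_add, Finset.sum_add_distrib]

/-- Pascal's rule applied twice. -/
theorem sum_choose_add_two_mul (N M : ℕ) (f : ℕ → R) :
    ∑ k ∈ Finset.range (N + 2), ((M + 2).choose k : R) * f k =
      ∑ k ∈ Finset.range (N + 2), (M.choose k : R) * f k +
        2 * ∑ k ∈ Finset.range (N + 1), (M.choose k : R) * f (k + 1) +
          ∑ k ∈ Finset.range N, (M.choose k : R) * f (k + 2) := by
  rw [sum_choose_succ_mul, sum_choose_succ_mul (N + 1), sum_choose_succ_mul N M (fun k => f (k + 1))]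
  ring

/-- After Pascal twice, u_{j+1} + 2u_j + u_{j-1} = m u_j; at the truncation point k = N only u_1 = 1
survives, leaving C(2N,N). -/
theorem sum_choose_two_mul_succ (u : ℕ → R) (m : R) (h0 : u 0 = 0) (h1 : u 1 = 1)
    (hu : ∀ n, u (n + 2) = (m - 2) * u (n + 1) - u n) (N : ℕ) :
    ∑ k ∈ Finset.range (N + 2), ((2 * (N + 1)).choose k : R) * u (N + 1 - k) =
      m * ∑ k ∈ Finset.range (N + 1), ((2 * N).choose k : R) * u (N - k) +
        ((2 * N).choose N : R) := by
  rcases N with _ | N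
  · simp [Finset.sum_range_succ, h0, h1]
  rw [show 2 * (N + 1 + 1) = 2 * (N + 1) + 2 by ring, sum_choose_add_two_mul]
  simp only [Finset.sum_range_succ]
  have e1 : N + 1 + 1 - N = 2 := by omega
  have e2 : N + 1 - N = 1 := by omega
  have key : ∀ k ∈ Finset.range N, ((2 * (N + 1)).choose k : R) * u (N + 1 - k) * m =
      ((2 * (N + 1)).choose k : R) * u (N + 1 + 1 - k) +
      2 * (((2 * (N + 1)).choose k : R) * u (N + 1 + 1 - (k + 1))) +
      ((2 * (N + 1)).choose k : R) * u (N + 1 + 1 - (k + 2)) := by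
    intro k hk
    have hk := Finset.mem_range.1 hk
    obtain ⟨j, rfl⟩ := Nat.exists_eq_add_of_lt hk
    rw [show k + j + 1 + 1 - k = j + 2 by omega, show k + j + 1 + 1 + 1 - k = (j + 1) + 2 by omega,
      show k + j + 1 + 1 + 1 - (k + 1) = j + 2 by omega,
      show k + j + 1 + 1 + 1 - (k + 2) = j + 1 by omega, hu (j + 1)]
    ring
  have keysum := Finset.sum_congr rfl key
  rw [Finset.sum_add_distrib, Finset.sum_add_distrib, ← Finset.sum_mul, ← Finset.mul_sum] at keysum
  have h2 : u 2 = m - 2 := by rw [hu 0, h0, h1]; ring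
  simp only [Nat.sub_self, h0, e1, e2, h1, h2, Nat.add_sub_add_right, Nat.add_sub_cancel_left]
    at keysum ⊢
  linear_combination -keysum

theorem pow_mul_sum_centralBinom_mul_pow (u : ℕ → R) (a m : R) (ham : a * m = 1) (h0 : u 0 = 0)
    (h1 : u 1 = 1) (hu : ∀ n, u (n + 2) = (m - 2) * u (n + 1) - u n) (N : ℕ) :
    a ^ N * ∑ k ∈ Finset.range (N + 1), ((2 * N).choose k : R) * u (N - k) =
      a * ∑ k ∈ Finset.range N, a ^ k * ((2 * k).choose k : R) := by
  induction N with
  | zero => simp [h0]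
  | succ N ih =>
    rw [sum_choose_two_mul_succ u m h0 h1 hu,
      Finset.sum_range_succ (fun k => a ^ k * ((2 * k).choose k : R)), mul_add, mul_add, ← ih]
    linear_combination (a ^ N * ∑ k ∈ Finset.range (N + 1), ((2 * N).choose k : R) * u (N - k)) * ham

/-- Each double Pascal step yields a factor m and shifts the index by one; the offset `a` absorbs
that shift in the induction. -/
theorem sum_choose_odd_mul (u : ℕ → R) (m : R)
    (hu : ∀ n, u (n + 2) = (m - 2) * u (n + 1) - u n) (n a : ℕ) :
    ∑ k ∈ Finset.range (2 * n + 1 + 1), ((2 * n + 1).choose k : R) * u (k + a) =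
      m ^ n * (u (n + a) + u (n + a + 1)) := by
  induction n generalizing a with
  | zero => simp [Finset.sum_range_succ, add_comm]
  | succ n ih =>
    rw [show 2 * (n + 1) + 1 + 1 = (2 * n + 1 + 1) + 2 by ring,
      show 2 * (n + 1) + 1 = (2 * n + 1 + 1) + 1 by ring, sum_choose_succ_mul_full,
      sum_choose_succ_mul_full (2 * n + 1) (fun k => u (k + a) + u (k + 1 + a))]
    have : ∀ k, u (k + a) + u (k + 1 + a) + (u (k + 1 + a) + u (k + 1 + 1 + a)) =
        m * u (k + (a + 1)) := by
      intro k
      rw [show k + 1 + 1 + a = k + a + 2 by ring, hu, show k + 1 + a = k + a + 1 by ring,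
        show k + (a + 1) = k + a + 1 by ring]
      ring
    simp only [this, mul_left_comm _ m, ← Finset.mul_sum, ih]
    rw [show n + 1 + a = n + (a + 1) by ring]
    ring

end BinomialSums

/-- Vandermonde: the two end terms give 2 C(p,k), and each inner term is a product of two multiples
of p. -/
theorem sq_dvd_choose_two_mul_sub {p k : ℕ} (hp : p.Prime) (hk0 : k ≠ 0) (hk : k < p) :
    ((p : ℤ) ^ 2) ∣ ((2 * p).choose k : ℤ) - 2 * (p.choose k : ℤ) := by
  obtain ⟨j, rfl⟩ := Nat.exists_eq_succ_of_ne_zero hk0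
  rw [two_mul p, Nat.add_choose_eq, Finset.Nat.sum_antidiagonal_eq_sum_range_succ_mk,
    Finset.sum_range_succ, Finset.sum_range_succ']
  have : p ^ 2 ∣ ∑ i ∈ Finset.range j, p.choose (i + 1) * p.choose (j.succ - (i + 1)) := by
    refine Finset.dvd_sum fun i hi => ?_
    have hi := Finset.mem_range.1 hi
    rw [sq]
    exact mul_dvd_mul (hp.dvd_choose_self (by omega) (by omega))
      (hp.dvd_choose_self (by omega) (by omega))
  have := Int.natCast_dvd_natCast.2 this
  push_cast at this ⊢
  simp only [Nat.sub_self, Nat.choose_zero_right, Nat.cast_one]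
  convert this using 1
  ring

/-- The correction `- u p` arises because the k = 0 coefficient is 1, not 2; the k = p term vanishes
by `h0`. -/
theorem sq_dvd_sum_choose_two_mul_sub {R : Type*} [CommRing R] {p : ℕ} (hp : p.Prime)
    (u : ℕ → R) (h0 : u 0 = 0) :
    ((p : R) ^ 2) ∣ ∑ k ∈ Finset.range (p + 1), ((2 * p).choose k : R) * u (p - k) -
      (2 * ∑ k ∈ Finset.range (p + 1), (p.choose k : R) * u k - u p) := by
  have hflip : ∑ k ∈ Finset.range (p + 1), (p.choose k : R) * u k =
      ∑ k ∈ Finset.range (p + 1), (p.choose k : R) * u (p - k) := by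
    rw [← Finset.sum_range_reflect]
    refine Finset.sum_congr rfl fun k hk => ?_
    have hk := Finset.mem_range.1 hk
    rw [show p + 1 - 1 - k = p - k by omega, Nat.choose_symm (by omega)]
  obtain ⟨q, rfl⟩ := Nat.exists_eq_succ_of_ne_zero hp.ne_zero
  rw [hflip, Finset.sum_range_succ, Finset.sum_range_succ', Finset.sum_range_succ _ q.succ,
    Finset.sum_range_succ' _ q]
  simp only [Nat.sub_self, h0, Nat.choose_zero_right, Nat.sub_zero]
  have : ∀ k ∈ Finset.range q, ((q.succ : ℕ) : R) ^ 2 ∣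
      ((2 * q.succ).choose (k + 1) : R) * u (q.succ - (k + 1)) -
        2 * ((q.succ.choose (k + 1) : R) * u (q.succ - (k + 1))) := by
    intro k hk
    have hk := Finset.mem_range.1 hk
    have h := map_dvd (Int.castRingHom R) (sq_dvd_choose_two_mul_sub hp (k := k + 1) (by omega) (by omega))
    simp only [eq_intCast, Int.cast_pow, Int.cast_natCast, Int.cast_sub, Int.cast_mul,
      Int.cast_ofNat] at h
    rw [← mul_assoc, ← sub_mul]
    exact h.mul_right _
  have := Finset.dvd_sum this
  rw [Finset.sum_sub_distrib, ← Finset.mul_sum] at this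
  convert this using 1
  push_cast
  ring

/-! ### Chebyshev-type values at twelfth roots of unity in `ℤ[√3]` -/

/-- The sequence `u_k(-√3, 1)`, which has period 12. -/
def lucasU : ℕ → ℤ√3
  | 0 => 0
  | 1 => 1
  | n + 2 => (⟨2, -1⟩ - 2) * lucasU (n + 1) - lucasU n

/-- The characteristic roots, those of x² + √3x + 1, are primitive twelfth roots of unity. -/
theorem lucasU_add_twelve (n : ℕ) : lucasU (n + 12) = lucasU n := by
  have h : ∀ n, lucasU (n + 2) = (⟨2, -1⟩ - 2) * lucasU (n + 1) - lucasU n := fun n => rfl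
  have hs : (⟨2, -1⟩ - 2 : ℤ√3) * (⟨2, -1⟩ - 2) = 3 := by decide
  simp only [h]
  generalize (⟨2, -1⟩ - 2 : ℤ√3) = s at hs
  generalize lucasU (n + 1) = x
  generalize lucasU n = y
  grind

theorem lucasU_mul_add (q r : ℕ) : lucasU (12 * q + r) = lucasU r := by
  induction q with
  | zero => simp
  | succ q ih => rw [show 12 * (q + 1) + r = 12 * q + r + 12 by ring, lucasU_add_twelve, ih]

theorem Zsqrtd.im_sum {ι : Type*} {d : ℤ} (s : Finset ι) (f : ι → ℤ√d) :
    (∑ k ∈ s, f k).im = ∑ k ∈ s, (f k).im :=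
  map_sum (AddMonoidHom.mk' Zsqrtd.im fun _ _ => rfl) f s

theorem Zsqrtd.re_sum {ι : Type*} {d : ℤ} (s : Finset ι) (f : ι → ℤ√d) :
    (∑ k ∈ s, f k).re = ∑ k ∈ s, (f k).re :=
  map_sum (AddMonoidHom.mk' Zsqrtd.re fun _ _ => rfl) f s

theorem im_pow_eq_seqS_and (k : ℕ) :
    ((⟨2, 1⟩ : ℤ√3) ^ k).im = seqS k ∧ 2 * ((⟨2, 1⟩ : ℤ√3) ^ k).re = seqT k := by
  induction k using Nat.twoStepInduction with
  | zero => simp [seqS, seqT]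
  | one => simp [seqS, seqT]
  | more n h1 h2 =>
    rw [seqS, seqT, ← h1.1, ← h1.2, ← h2.1, ← h2.2]
    simp only [pow_succ, Zsqrtd.re_mul, Zsqrtd.im_mul]
    constructor <;> ring

/-! ### Congruences modulo a prime and its square in `ℤ[√3]` -/

theorem sq_dvd_sum_centralBinom_sub {p n : ℕ} (hp : p.Prime) (hn : p = 2 * n + 1) :
    ((p : ℤ√3) ^ 2) ∣ ∑ k ∈ Finset.range p, (⟨2, 1⟩ : ℤ√3) ^ k * ((2 * k).choose k : ℤ√3) -
      (2 * ⟨2, 1⟩ ^ n * (lucasU n + lucasU (n + 1)) - (⟨2, 1⟩ ^ n) ^ 2 * lucasU p) := by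
  set a : ℤ√3 := ⟨2, 1⟩ with ha
  have ham : a * ⟨2, -1⟩ = 1 := by decide
  have hG := pow_mul_sum_centralBinom_mul_pow lucasU a ⟨2, -1⟩ ham rfl rfl (fun _ => rfl) p
  have hW := sum_choose_odd_mul lucasU ⟨2, -1⟩ (fun _ => rfl) n 0
  have hD := sq_dvd_sum_choose_two_mul_sub hp lucasU rfl
  simp only [add_zero, ← hn] at hW
  have hpow : (a * ⟨2, -1⟩) ^ n = 1 := by rw [ham, one_pow]
  rw [mul_pow] at hpow
  have hpa : a ^ p = a ^ n * a ^ n * a := by rw [hn]; ring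
  rw [hW] at hD
  rw [hpa] at hG
  generalize (∑ k ∈ Finset.range (p + 1), ((2 * p).choose k : ℤ√3) * lucasU (p - k)) = G at *
  generalize (∑ k ∈ Finset.range p, a ^ k * ((2 * k).choose k : ℤ√3)) = A at *
  generalize (⟨2, -1⟩ : ℤ√3) ^ n = M at *
  have hA : A = a ^ n * a ^ n * G := by
    linear_combination -A * ham + a ^ n * a ^ n * G * ham - (⟨2, -1⟩ : ℤ√3) * hG
  convert hD.mul_left (a ^ n * a ^ n) using 1
  rw [hA]
  linear_combination (2 * a ^ n * (lucasU n + lucasU (n + 1))) * hpow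

/-- Frobenius applied to 1 + √3, whose square is 2(2 + √3). -/
theorem dvd_two_pow_mul_pow_sub {p n : ℕ} (hp : p.Prime) (hn : p = 2 * n + 1) :
    (p : ℤ√3) ∣ 2 ^ n * ⟨2, 1⟩ ^ n * ⟨1, 1⟩ - (1 + 3 ^ n * ⟨0, 1⟩) := by
  obtain ⟨r, hr⟩ := exists_add_pow_prime_eq hp (1 : ℤ√3) ⟨0, 1⟩
  have e1 : (1 : ℤ√3) + ⟨0, 1⟩ = ⟨1, 1⟩ := by decide
  have e2 : (⟨1, 1⟩ : ℤ√3) ^ 2 = 2 * ⟨2, 1⟩ := by decide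
  have e3 : (⟨0, 1⟩ : ℤ√3) ^ 2 = 3 := by decide
  have e4 : (⟨1, 1⟩ : ℤ√3) ^ p = 2 ^ n * ⟨2, 1⟩ ^ n * ⟨1, 1⟩ := by
    rw [hn, pow_succ, pow_mul, e2, mul_pow]
  have e5 : (⟨0, 1⟩ : ℤ√3) ^ p = 3 ^ n * ⟨0, 1⟩ := by
    rw [hn, pow_succ, pow_mul, e3]
  rw [e1, e4, e5, one_pow] at hr
  exact ⟨1 * ⟨0, 1⟩ * r, by rw [hr]; ring⟩

theorem dvd_pow_sub_jacobiSym {p n : ℕ} (hp : p.Prime) (hn : p = 2 * n + 1) (a : ℤ) :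
    (p : ℤ) ∣ a ^ n - jacobiSym a p := by
  have := Fact.mk hp
  rw [← jacobiSym.legendreSym.to_jacobiSym, ← ZMod.intCast_zmod_eq_zero_iff_dvd]
  push_cast
  rw [legendreSym.eq_pow, show p / 2 = n by omega, sub_self]

theorem dvd_pow_sub_of_mul_eq {p n : ℕ} (hp : p.Prime) (hn : p = 2 * n + 1) (c : ℤ√3)
    (hc : (jacobiSym 2 p : ℤ√3) * ⟨1, 1⟩ * c = 1 + (jacobiSym 3 p : ℤ√3) * ⟨0, 1⟩)
    (h2 : jacobiSym 2 p * jacobiSym 2 p = 1) :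
    (p : ℤ√3) ∣ ⟨2, 1⟩ ^ n - c := by
  obtain ⟨x, hx⟩ := dvd_two_pow_mul_pow_sub hp hn
  obtain ⟨y, hy⟩ := dvd_pow_sub_jacobiSym hp hn 2
  obtain ⟨z, hz⟩ := dvd_pow_sub_jacobiSym hp hn 3
  have hy' := congrArg (Int.cast : ℤ → ℤ√3) hy
  have hz' := congrArg (Int.cast : ℤ → ℤ√3) hz
  have h2' := congrArg (Int.cast : ℤ → ℤ√3) h2
  push_cast at hy' hz' h2'
  have e : (⟨1, 1⟩ : ℤ√3) * ⟨-1, 1⟩ = 2 := by decide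
  have hp' : (p : ℤ√3) = 2 * n + 1 := by rw [hn]; push_cast; ring
  generalize (jacobiSym 2 p : ℤ√3) = s at *
  generalize (jacobiSym 3 p : ℤ√3) = t at *
  set D := (⟨2, 1⟩ : ℤ√3) ^ n with hD
  -- Multiplying by s(-1 + √3) inverts s(1 + √3) up to the factor 2, which is then removed using 1 =
  -- p - 2n.
  have h : (p : ℤ√3) ∣ 2 * (D - c) := by
    refine ⟨s * ⟨-1, 1⟩ * (x + z * ⟨0, 1⟩ - y * D * ⟨1, 1⟩), ?_⟩
    linear_combination (s * ⟨-1, 1⟩) * (hx - hc + hz' * ⟨0, 1⟩ - hy' * D * ⟨1, 1⟩) - (D - c) * e - (D - c) * ⟨1, 1⟩ * ⟨-1, 1⟩ * h2'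
  obtain ⟨w, hw⟩ := h
  exact ⟨(D - c) - n * w, by linear_combination -(D - c) * hp' - n * hw⟩

/-- With D = a^n and u_p² = 1, 2Dg - D²u_p = u_p g² - u_p(D - u_p g)², and p divides D - u_p g. -/
theorem sq_dvd_sum_centralBinom_sub_of_mul_eq {p n : ℕ} (hp : p.Prime) (hn : p = 2 * n + 1)
    (hb : lucasU p * lucasU p = 1)
    (hc : (jacobiSym 2 p : ℤ√3) * ⟨1, 1⟩ * (lucasU p * (lucasU n + lucasU (n + 1))) =
      1 + (jacobiSym 3 p : ℤ√3) * ⟨0, 1⟩)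
    (h2 : jacobiSym 2 p * jacobiSym 2 p = 1) :
    ((p : ℤ√3) ^ 2) ∣ ∑ k ∈ Finset.range p, (⟨2, 1⟩ : ℤ√3) ^ k * ((2 * k).choose k : ℤ√3) -
      lucasU p * (lucasU n + lucasU (n + 1)) ^ 2 := by
  obtain ⟨x, hx⟩ := sq_dvd_sum_centralBinom_sub hp hn
  obtain ⟨y, hy⟩ := dvd_pow_sub_of_mul_eq hp hn _ hc h2
  generalize lucasU n + lucasU (n + 1) = g at *
  generalize (⟨2, 1⟩ : ℤ√3) ^ n = D at *
  refine ⟨x - lucasU p * y ^ 2, ?_⟩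
  linear_combination hx - lucasU p * (D - lucasU p * g + p * y) * hy +
    (lucasU p * g ^ 2 - 2 * D * g) * hb

/-! ### Morgan-Voyce sums -/

theorem sum_choose_add_mul_pow_recurrence {R : Type*} [CommRing R] (x : R) (n : ℕ) :
    ∑ k ∈ Finset.range (n + 2), ((n + 1 + k).choose (2 * k) : R) * x ^ k =
      ∑ k ∈ Finset.range (n + 1), ((n + k).choose (2 * k) : R) * x ^ k +
        x * ∑ k ∈ Finset.range (n + 1), ((n + 1 + k).choose (2 * k + 1) : R) * x ^ k := by
  have : ∑ k ∈ Finset.range (n + 1), ((n + k).choose (2 * k) : R) * x ^ k =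
      ∑ k ∈ Finset.range (n + 2), ((n + k).choose (2 * k) : R) * x ^ k := by
    rw [Finset.sum_range_succ _ (n + 1), Nat.choose_eq_zero_of_lt (by omega)]; simp
  rw [this, Finset.sum_range_succ' _ (n + 1), Finset.sum_range_succ' _ (n + 1), Finset.mul_sum]
  simp only [add_zero]
  rw [add_right_comm, ← Finset.sum_add_distrib]
  congr 1
  · refine Finset.sum_congr rfl fun k _ => ?_
    rw [show n + 1 + (k + 1) = (n + 1 + k) + 1 by ring, show 2 * (k + 1) = (2 * k + 1) + 1 by ring,
      Nat.choose_succ_succ', show n + (k + 1) = n + 1 + k by ring]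
    push_cast
    ring
  · simp

theorem sum_choose_add_succ_mul_pow_recurrence {R : Type*} [CommRing R] (x : R) (n : ℕ) :
    ∑ k ∈ Finset.range (n + 2), ((n + 2 + k).choose (2 * k + 1) : R) * x ^ k =
      ∑ k ∈ Finset.range (n + 1), ((n + 1 + k).choose (2 * k + 1) : R) * x ^ k +
        ∑ k ∈ Finset.range (n + 2), ((n + 1 + k).choose (2 * k) : R) * x ^ k := by
  have : ∑ k ∈ Finset.range (n + 1), ((n + 1 + k).choose (2 * k + 1) : R) * x ^ k =
      ∑ k ∈ Finset.range (n + 2), ((n + 1 + k).choose (2 * k + 1) : R) * x ^ k := by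
    rw [Finset.sum_range_succ _ (n + 1), Nat.choose_eq_zero_of_lt (by omega)]; simp
  rw [this, ← Finset.sum_add_distrib]
  refine Finset.sum_congr rfl fun k _ => ?_
  rw [show n + 2 + k = (n + 1 + k) + 1 by ring, Nat.choose_succ_succ']
  push_cast
  ring

/-- The pair of Morgan-Voyce values `(b_n(x), B_n(x))` at `x = -(2 + √3)`, by recursion. -/
def morganVoyce : ℕ → ℤ√3 × ℤ√3
  | 0 => (1, 1)
  | n + 1 => ((morganVoyce n).1 + ⟨-2, -1⟩ * (morganVoyce n).2,
      (morganVoyce n).2 + ((morganVoyce n).1 + ⟨-2, -1⟩ * (morganVoyce n).2))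

theorem morganVoyce_eq_sum (n : ℕ) : morganVoyce n =
    (∑ k ∈ Finset.range (n + 1), ((n + k).choose (2 * k) : ℤ√3) * ⟨-2, -1⟩ ^ k,
      ∑ k ∈ Finset.range (n + 1), ((n + 1 + k).choose (2 * k + 1) : ℤ√3) * ⟨-2, -1⟩ ^ k) := by
  induction n with
  | zero => simp [morganVoyce]
  | succ n ih =>
    rw [morganVoyce, ih, sum_choose_add_succ_mul_pow_recurrence,
      sum_choose_add_mul_pow_recurrence]

/-- The step matrix has determinant 1 and trace -√3, so its sixth power is -1. -/
theorem morganVoyce_mul_add (q r : ℕ) : morganVoyce (12 * q + r) = morganVoyce r := by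
  have hs : (⟨-2, -1⟩ : ℤ√3) * ⟨-2, -1⟩ = -1 - 4 * ⟨-2, -1⟩ := by decide
  have h1 : ∀ n, morganVoyce (n + 1) = ((morganVoyce n).1 + ⟨-2, -1⟩ * (morganVoyce n).2,
      (morganVoyce n).2 + ((morganVoyce n).1 + ⟨-2, -1⟩ * (morganVoyce n).2)) := fun n => rfl
  generalize (⟨-2, -1⟩ : ℤ√3) = s at hs h1
  have h2 : ∀ n, morganVoyce (n + 2) =
      ((1 + s) * (morganVoyce n).1 - (1 + 2 * s) * (morganVoyce n).2,
        (2 + s) * (morganVoyce n).1 - s * (morganVoyce n).2) := by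
    intro n
    rw [h1, h1]
    ext1
    · linear_combination (morganVoyce n).2 * hs
    · linear_combination (morganVoyce n).2 * hs
  have h4 : ∀ n, morganVoyce (n + 4) =
      (s * (morganVoyce n).1 - (1 + 2 * s) * (morganVoyce n).2,
        (2 + s) * (morganVoyce n).1 - (1 + s) * (morganVoyce n).2) := by
    intro n
    rw [h2, h2]
    ext1
    · linear_combination -(morganVoyce n).1 * hs
    · linear_combination -(morganVoyce n).2 * hs
  have h6 : ∀ n, morganVoyce (n + 6) = (-(morganVoyce n).1, -(morganVoyce n).2) := by
    intro n
    rw [h4, h2]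
    ext1
    · linear_combination -(morganVoyce n).1 * hs
    · linear_combination -(morganVoyce n).2 * hs
  have h : ∀ n, morganVoyce (n + 12) = morganVoyce n := fun n => by
    rw [h6, h6]
    simp only [neg_neg]
  induction q with
  | zero => simp
  | succ q ih => rw [show 12 * (q + 1) + r = 12 * q + r + 12 by ring, h, ih]

/-- Consecutive C(n+k,2k) have ratio (n+k+1)(n-k)/((2k+2)(2k+1)), and 4(n+k+1)(n-k) = p² - (2k+1)².
-/
theorem sq_dvd_choose_add_sub_centralBinom {p n : ℕ} (hp : p.Prime) (hn : p = 2 * n + 1) (k : ℕ)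
    (hk : k ≤ n) :
    ((p : ℤ) ^ 2) ∣ (-16) ^ k * ((n + k).choose (2 * k) : ℤ) - ((2 * k).choose k : ℤ) := by
  induction k with
  | zero => simp
  | succ k ih =>
    obtain ⟨x, hx⟩ := ih (by omega)
    obtain ⟨j, rfl⟩ := Nat.exists_eq_add_of_lt (show k < n by omega)
    have h1 : ((k + j + 1 + (k + 1)).choose (2 * (k + 1)) : ℤ) * ((2 * k + 2) * (2 * k + 1)) =
        ((k + j + 1 + k).choose (2 * k)) * ((2 * k + j + 2) * (j + 1)) := by
      have a1 := Nat.add_one_mul_choose_eq (k + j + 1 + k) (2 * k + 1)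
      have a2 := Nat.choose_succ_right_eq (k + j + 1 + k) (2 * k)
      rw [show k + j + 1 + k - 2 * k = j + 1 by omega] at a2
      zify at a1 a2
      rw [show k + j + 1 + (k + 1) = k + j + 1 + k + 1 by ring,
        show 2 * (k + 1) = 2 * k + 1 + 1 by ring]
      linear_combination -(2 * k + 1 : ℤ) * a1 + (2 * k + j + 2 : ℤ) * a2
    have h2 : ((2 * (k + 1)).choose (k + 1) : ℤ) * (k + 1) = 2 * (2 * k + 1) * (2 * k).choose k := by
      have := Nat.succ_mul_centralBinom_succ k
      simp only [Nat.centralBinom] at this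
      zify at this
      linear_combination this
    have hp' : (p : ℤ) = 2 * (k + j + 1) + 1 := by rw [hn]; push_cast; ring
    -- Both factors are positive and less than p, since k < n.
    have hcop : IsCoprime ((p : ℤ) ^ 2) ((2 * k + 2) * (2 * k + 1)) := by
      apply IsCoprime.pow_left
      apply IsCoprime.mul_right
      · have := Nat.coprime_of_lt_prime (n := 2 * k + 2) (by omega) (by omega) hp
        exact_mod_cast Nat.isCoprime_iff_coprime.2 this
      · have := Nat.coprime_of_lt_prime (n := 2 * k + 1) (by omega) (by omega) hp
        exact_mod_cast Nat.isCoprime_iff_coprime.2 this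
    refine hcop.dvd_of_dvd_mul_right ⟨4 * (2 * k + 1) ^ 2 * x -
      4 * (-16) ^ k * ((k + j + 1 + k).choose (2 * k)), ?_⟩
    rw [pow_succ (-16 : ℤ)]
    linear_combination (-16) ^ k * (-16) * h1 - 2 * (2 * k + 1 : ℤ) * h2 +
      4 * (2 * k + 1 : ℤ) ^ 2 * hx +
      4 * (-16) ^ k * ((k + j + 1 + k).choose (2 * k) : ℤ) * (p + 2 * (k + j + 1) + 1 : ℤ) * hp'

theorem ratModEq_sum_div_sixteen_pow {p n : ℕ} (hp : p.Prime) (hn : p = 2 * n + 1) (s : ℕ → ℤ) :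
    RatModEq (p ^ 2)
      (∑ k ∈ Finset.range (n + 1), (s k : ℚ) / (16 : ℚ) ^ k * (Nat.choose (2 * k) k : ℚ))
      ((∑ k ∈ Finset.range (n + 1), s k * ((-1) ^ k * ((n + k).choose (2 * k) : ℤ)) : ℤ) : ℚ) := by
  have h : ∀ k : ℕ, ∃ x : ℤ, k ∈ Finset.range (n + 1) →
      (-16) ^ k * ((n + k).choose (2 * k) : ℤ) - ((2 * k).choose k : ℤ) = (p : ℤ) ^ 2 * x := by
    intro k
    by_cases hk : k ∈ Finset.range (n + 1)
    · obtain ⟨x, hx⟩ := sq_dvd_choose_add_sub_centralBinom hp hn k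
        (by have := Finset.mem_range.1 hk; omega)
      exact ⟨x, fun _ => hx⟩
    · exact ⟨0, fun h => absurd h hk⟩
  choose x hx using h
  -- Numerator over the common denominator 16^n, which is prime to the odd p.
  set Z : ℤ := ∑ k ∈ Finset.range (n + 1), -(s k * x k * 16 ^ (n - k)) with hZ
  refine ⟨(Z : ℚ) / ((16 ^ n : ℤ) : ℚ), ?_, ?_⟩
  · have hcop : Nat.Coprime 16 p := by
      rw [show 16 = 2 ^ 4 by norm_num]
      refine Nat.Coprime.pow_left _ ?_
      rw [hn, Nat.coprime_two_left]
      exact odd_two_mul_add_one n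
    have hden : ((Z : ℚ) / ((16 ^ n : ℤ) : ℚ)).den ∣ 16 ^ n := by
      have := Rat.den_dvd Z (16 ^ n)
      rw [Rat.divInt_eq_div] at this
      exact_mod_cast this
    exact Nat.Coprime.coprime_dvd_left hden ((hcop.pow_left n).pow_right 2)
  · rw [Int.cast_sum, ← Finset.sum_sub_distrib, hZ, Int.cast_sum, Finset.sum_div, Finset.mul_sum]
    refine Finset.sum_congr rfl fun k hk => ?_
    have h1 := congrArg (Int.cast : ℤ → ℚ) (hx k hk)
    have hk := Finset.mem_range.1 hk
    obtain ⟨j, rfl⟩ := Nat.exists_eq_add_of_le (show k ≤ n by omega)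
    rw [Nat.add_sub_cancel_left]
    rw [show (-16 : ℤ) = (-1) * 16 by norm_num, mul_pow] at h1
    push_cast at h1 ⊢
    rw [pow_add]
    field_simp
    linear_combination -(s k : ℚ) * h1

/-! ### Evaluation by residue class modulo 24 -/

theorem sum_seqS_seqT_mul_choose (n : ℕ) :
    ∑ k ∈ Finset.range (n + 1), seqS k * ((-1) ^ k * ((n + k).choose (2 * k) : ℤ)) =
        (morganVoyce n).1.im ∧
      ∑ k ∈ Finset.range (n + 1), seqT k * ((-1) ^ k * ((n + k).choose (2 * k) : ℤ)) =
        2 * (morganVoyce n).1.re := by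
  have h : (morganVoyce n).1 = ∑ k ∈ Finset.range (n + 1),
      (((-1) ^ k * ((n + k).choose (2 * k) : ℤ) : ℤ) : ℤ√3) * ⟨2, 1⟩ ^ k := by
    simp only [morganVoyce_eq_sum]
    refine Finset.sum_congr rfl fun k _ => ?_
    rw [show (⟨-2, -1⟩ : ℤ√3) = -1 * ⟨2, 1⟩ by decide, mul_pow]
    push_cast
    ring
  rw [h, Zsqrtd.im_sum, Zsqrtd.re_sum, Finset.mul_sum]
  constructor <;> refine Finset.sum_congr rfl fun k _ => ?_
  · rw [← (im_pow_eq_seqS_and k).1, Zsqrtd.im_smul]; ring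
  · rw [← (im_pow_eq_seqS_and k).2, Zsqrtd.re_smul]; ring

/-- Imaginary parts of d·c with d = 1 and d = 2 + √3; the second multiplier shifts S_k to S_{k+1}.
-/
theorem sum_seqS_congr {p : ℕ} {c : ℤ√3}
    (h : ((p : ℤ√3) ^ 2) ∣
      ∑ k ∈ Finset.range p, (⟨2, 1⟩ : ℤ√3) ^ k * ((2 * k).choose k : ℤ√3) - c) :
    (∑ k ∈ Finset.range p, seqS k * (Nat.choose (2 * k) k : ℤ) ≡ c.im [ZMOD ((p : ℤ) ^ 2)]) ∧
    (∑ k ∈ Finset.range p, seqS (k + 1) * (Nat.choose (2 * k) k : ℤ) ≡ c.re + 2 * c.im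
      [ZMOD ((p : ℤ) ^ 2)]) := by
  have key : ∀ d : ℤ√3, (d * c).im ≡ ∑ k ∈ Finset.range p, (d * ⟨2, 1⟩ ^ k).im *
      (Nat.choose (2 * k) k : ℤ) [ZMOD ((p : ℤ) ^ 2)] := by
    intro d
    have hd := h.mul_left d
    rw [show ((p : ℤ√3) ^ 2) = (((p : ℤ) ^ 2 : ℤ) : ℤ√3) by push_cast; rfl,
      Zsqrtd.intCast_dvd] at hd
    have := hd.2
    rw [mul_sub, Finset.mul_sum, Zsqrtd.im_sub, Zsqrtd.im_sum] at this
    rw [Int.modEq_iff_dvd]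
    convert this using 3 with k
    rw [← mul_assoc, mul_comm, mul_comm (d * _), ← Int.cast_natCast (R := ℤ√3), Zsqrtd.im_smul]
  constructor
  · have := (key 1).symm
    simpa only [one_mul, (im_pow_eq_seqS_and _).1] using this
  · have := (key ⟨2, 1⟩).symm
    simp only [← pow_succ', (im_pow_eq_seqS_and _).1] at this
    rw [Zsqrtd.im_mul] at this
    convert this using 1
    ring

theorem theorem1p3 (p : ℕ) (hp : p.Prime) (hp3 : 3 < p) :
    (∑ k ∈ Finset.range p, seqS k * (Nat.choose (2 * k) k : ℤ) ≡
        2 * (jacobiSym (p : ℤ) 3 - jacobiSym (-1) p) [ZMOD ((p : ℤ) ^ 2)]) ∧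
    (∑ k ∈ Finset.range p, seqS (k + 1) * (Nat.choose (2 * k) k : ℤ) ≡
        jacobiSym (p : ℤ) 3 [ZMOD ((p : ℤ) ^ 2)]) ∧
    RatModEq (p ^ 2)
      (∑ k ∈ Finset.range ((p - 1) / 2 + 1),
        (seqS k : ℚ) / (16 : ℚ) ^ k * (Nat.choose (2 * k) k : ℚ))
      (((jacobiSym 6 p : ℚ) - (jacobiSym 2 p : ℚ)) / 2) ∧
    RatModEq (p ^ 2)
      (∑ k ∈ Finset.range ((p - 1) / 2 + 1),
        (seqT k : ℚ) / (16 : ℚ) ^ k * (Nat.choose (2 * k) k : ℚ))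
      (3 * (jacobiSym 6 p : ℚ) - (jacobiSym 2 p : ℚ)) := by
  have h2 : p % 2 ≠ 0 := fun h => by
    have := (Nat.prime_dvd_prime_iff_eq Nat.prime_two hp).1 (Nat.dvd_of_mod_eq_zero h)
    omega
  have h3 : p % 3 ≠ 0 := fun h => by
    have := (Nat.prime_dvd_prime_iff_eq Nat.prime_three hp).1 (Nat.dvd_of_mod_eq_zero h)
    omega
  obtain ⟨q, r, hr, hpq⟩ : ∃ q r : ℕ, r ∈ ({1, 5, 7, 11, 13, 17, 19, 23} : Finset ℕ) ∧
      p = 24 * q + r := by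
    refine ⟨p / 24, p % 24, ?_, by omega⟩
    simp only [Finset.mem_insert, Finset.mem_singleton]
    omega
  obtain ⟨n, hn, hnq⟩ : ∃ n, p = 2 * n + 1 ∧ n = 12 * q + r / 2 := by
    refine ⟨p / 2, by omega, ?_⟩
    simp only [Finset.mem_insert, Finset.mem_singleton] at hr
    omega
  have hpr : p % 24 = r := by
    simp only [Finset.mem_insert, Finset.mem_singleton] at hr
    omega
  have j2 : jacobiSym 2 p = jacobiSym 2 (r % 8) := by
    rw [jacobiSym.mod_right 2 (by rw [Nat.odd_iff]; omega), ← hpr]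
    congr 1
    simp
  have j6 : jacobiSym 6 p = jacobiSym 6 r := by
    rw [jacobiSym.mod_right 6 (by rw [Nat.odd_iff]; omega), ← hpr]
    rfl
  have j3 : jacobiSym 3 p = jacobiSym 3 (r % 12) := by
    rw [jacobiSym.mod_right 3 (by rw [Nat.odd_iff]; omega), ← hpr]
    congr 1
    simp
  have jm : jacobiSym (-1) p = jacobiSym (-1) (r % 4) := by
    rw [jacobiSym.mod_right (-1) (by rw [Nat.odd_iff]; omega), ← hpr]
    congr 1
    simp
  have jp : jacobiSym (p : ℤ) 3 = jacobiSym (r % 3 : ℤ) 3 := by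
    rw [jacobiSym.mod_left, hpq]
    congr 1
    push_cast
    omega
  have un : lucasU n = lucasU (r / 2) := by rw [hnq, lucasU_mul_add]
  have un1 : lucasU (n + 1) = lucasU (r / 2 + 1) := by rw [hnq, add_assoc, lucasU_mul_add]
  have up : lucasU p = lucasU r := by
    rw [hpq, show 24 * q = 12 * (2 * q) by ring, lucasU_mul_add]
  have mv : morganVoyce n = morganVoyce (r / 2) := by rw [hnq, morganVoyce_mul_add]
  have hmain := sq_dvd_sum_centralBinom_sub_of_mul_eq hp hn
  have hS := ratModEq_sum_div_sixteen_pow hp hn seqS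
  have hT := ratModEq_sum_div_sixteen_pow hp hn seqT
  rw [(sum_seqS_seqT_mul_choose n).1] at hS
  rw [(sum_seqS_seqT_mul_choose n).2] at hT
  rw [show (p - 1) / 2 = n by omega]
  have e6 : ((jacobiSym 6 p : ℚ) - (jacobiSym 2 p : ℚ)) / 2 = ((morganVoyce n).1.im : ℚ) ∧
      3 * (jacobiSym 6 p : ℚ) - (jacobiSym 2 p : ℚ) = ((2 * (morganVoyce n).1.re : ℤ) : ℚ) ∧
      2 * (jacobiSym (p : ℤ) 3 - jacobiSym (-1) p) =
        (lucasU p * (lucasU n + lucasU (n + 1)) ^ 2).im ∧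
      jacobiSym (p : ℤ) 3 = (lucasU p * (lucasU n + lucasU (n + 1)) ^ 2).re +
        2 * (lucasU p * (lucasU n + lucasU (n + 1)) ^ 2).im ∧
      lucasU p * lucasU p = 1 ∧ (jacobiSym 2 p : ℤ√3) * ⟨1, 1⟩ *
        (lucasU p * (lucasU n + lucasU (n + 1))) = 1 + (jacobiSym 3 p : ℤ√3) * ⟨0, 1⟩ ∧
      jacobiSym 2 p * jacobiSym 2 p = 1 := by
    -- By periodicity every quantity depends only on r = p mod 24, so eight cases are decided by
    -- computation.
    have aux : ∀ r ∈ ({1, 5, 7, 11, 13, 17, 19, 23} : Finset ℕ),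
      jacobiSym 6 r - jacobiSym 2 (r % 8) = 2 * (morganVoyce (r / 2)).1.im ∧
      3 * jacobiSym 6 r - jacobiSym 2 (r % 8) = 2 * (morganVoyce (r / 2)).1.re ∧
      2 * (jacobiSym (r % 3 : ℤ) 3 - jacobiSym (-1) (r % 4)) =
        (lucasU r * (lucasU (r / 2) + lucasU (r / 2 + 1)) ^ 2).im ∧
      jacobiSym (r % 3 : ℤ) 3 = (lucasU r * (lucasU (r / 2) + lucasU (r / 2 + 1)) ^ 2).re +
        2 * (lucasU r * (lucasU (r / 2) + lucasU (r / 2 + 1)) ^ 2).im ∧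
      lucasU r * lucasU r = 1 ∧ (jacobiSym 2 (r % 8) : ℤ√3) * ⟨1, 1⟩ *
        (lucasU r * (lucasU (r / 2) + lucasU (r / 2 + 1))) =
          1 + (jacobiSym 3 (r % 12) : ℤ√3) * ⟨0, 1⟩ ∧
      jacobiSym 2 (r % 8) * jacobiSym 2 (r % 8) = 1 := by
      intro r hr
      simp only [Finset.mem_insert, Finset.mem_singleton] at hr
      rcases hr with rfl | rfl | rfl | rfl | rfl | rfl | rfl | rfl <;> (norm_num1; decide)
    rw [j2, j6, j3, jm, jp, un, un1, up, mv]
    obtain ⟨a1, a2, a3⟩ := aux r hr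
    refine ⟨?_, ?_, a3⟩
    · rw [div_eq_iff two_ne_zero, mul_comm]; exact_mod_cast a1
    · exact_mod_cast a2
  obtain ⟨a1, a2, a3, a4, a5, a6, a7⟩ := e6
  obtain ⟨c1, c2⟩ := sum_seqS_congr (hmain a5 a6 a7)
  rw [a1, a2, a3, a4]
  exact ⟨c1, c2, hS, hT⟩
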